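/- For a polynomial $f(x)\in\mathbb{Q}[x]$, let $\operatorname{denom}(f(x))$ denote the smallest positive integer $d$ such that $d\cdot f(x)\in\mathbb{Z}[x]$. Let $B_n(x)$ be the $n$th Bernoulli polynomial, defined by $\frac{te^{xt}}{e^t-1}=\sum_{n\ge 0}B_n(x)\frac{t^n}{n!}$, and let $B_n=B_n(0)$ be the $n$th Bernoulli number. For $n\ge 1$ set $$\mathfrak{D}_n:=\operatorname{denom}\bigl(B_n(x)-B_n\bigr),\qquad \mathfrak{B}_n:=\operatorname{denom}\bigl(B_n(x)\bigr),$$ and for $k\ge 1$ let $\operatorname{rad}(k):=\prod_{p\mid k}p$ be the product of the distinct primes $p$ dividing $k$. Then the following hold. (i) We have the relations $$\mathfrak{D}_n=\operatorname{lcm}\bigl(\mathfrak{D}_{n+1},\operatorname{rad}(n+1)\bigr)\quad\text{if } n\ge 3 \text{ is odd},$$ $$\mathfrak{B}_n=\operatorname{lcm}\bigl(\mathfrak{B}_{n+1},\operatorname{rad}(n+1)\bigr)\quad\text{if } n\ge 2 \text{ is even}.$$ (ii) We have the divisibilities $$\mathfrak{D}_{n+1}\mid\mathfrak{D}_n\quad\text{if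 } n\ge 1 \text{ is odd},$$ $$\mathfrak{B}_{n+1}\mid\mathfrak{B}_n\quad\text{if } n\ge 2 \text{ is even}.$$ -/

import Mathlib

namespace BernoulliDenom

open Polynomial

/-- The denominator of `f ∈ ℚ[x]`: the smallest positive integer `d` with `d · f ∈ ℤ[x]`.
The set is never empty, see `isLeast_denom`. -/
noncomputable def denom (f : ℚ[X]) : ℕ :=
  sInf {d : ℕ | 0 < d ∧ ∃ g : ℤ[X], g.map (Int.castRingHom ℚ) = (d : ℚ) • f}

/-- The minimum in the definition of `denom` is attained. -/
theorem isLeast_denom (f : ℚ[X]) :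
    IsLeast {d : ℕ | 0 < d ∧ ∃ g : ℤ[X], g.map (Int.castRingHom ℚ) = (d : ℚ) • f} (denom f) := by
  have hne : {d : ℕ | 0 < d ∧
      ∃ g : ℤ[X], g.map (Int.castRingHom ℚ) = (d : ℚ) • f}.Nonempty := by
    obtain ⟨b, hb, h⟩ := IsLocalization.integerNormalization_spec (nonZeroDivisors ℤ) f
    have hb0 : b ≠ 0 := nonZeroDivisors.ne_zero hb
    refine ⟨b.natAbs, Int.natAbs_pos.mpr hb0,
      C b.sign * IsLocalization.integerNormalization (nonZeroDivisors ℤ) f, ?_⟩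
    have h' : (IsLocalization.integerNormalization (nonZeroDivisors ℤ) f).map
        (Int.castRingHom ℚ) = b • f := h
    have hs : ((b.sign : ℤ) : ℚ) * (b : ℚ) = ((b.natAbs : ℕ) : ℚ) := by
      rw [← Int.cast_mul, Int.sign_mul_self_eq_natAbs, Int.cast_natCast]
    rw [Polynomial.map_mul, h', ← hs, Polynomial.map_C, ← Int.cast_smul_eq_zsmul ℚ b f,
      ← Polynomial.smul_eq_C_mul, smul_smul]
    simp
  exact ⟨Nat.sInf_mem hne, fun _ hd => Nat.sInf_le hd⟩

/-- `𝔇_n`, the denominator of `B_n(x) - B_n`. -/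
noncomputable def fD (n : ℕ) : ℕ :=
  denom (Polynomial.bernoulli n - C (_root_.bernoulli n))

/-- `𝔅_n`, the denominator of `B_n(x)`. -/
noncomputable def fB (n : ℕ) : ℕ :=
  denom (Polynomial.bernoulli n)

end BernoulliDenom

namespace BernoulliDenom

open Polynomial

/-! ### Denominators of rational numbers -/

theorem den_dvd_iff_exists_int (q : ℚ) (d : ℕ) : q.den ∣ d ↔ ∃ z : ℤ, (z : ℚ) = d * q := by
  constructor
  · rintro ⟨e, rfl⟩
    refine ⟨e * q.num, ?_⟩
    push_cast
    rw [← Rat.den_mul_eq_num q]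
    ring
  · rintro ⟨z, hz⟩
    rcases Nat.eq_zero_or_pos d with rfl | hd
    · exact dvd_zero _
    have hq : q = Rat.divInt z d := by
      have : (d : ℚ) ≠ 0 := by positivity
      rw [Rat.divInt_eq_div, hz]
      push_cast
      field_simp
    rw [hq]
    exact_mod_cast Rat.den_dvd z d

theorem den_add_of_coprime {a b : ℚ} (h : a.den.Coprime b.den) :
    (a + b).den = a.den * b.den := by
  refine Nat.dvd_antisymm (Rat.add_den_dvd a b) (h.mul_dvd_of_dvd_of_dvd ?_ ?_)
  · refine h.dvd_of_dvd_mul_right ?_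
    simpa using Rat.sub_den_dvd (a + b) b
  · refine h.symm.dvd_of_dvd_mul_right ?_
    simpa using Rat.sub_den_dvd (a + b) a

theorem prime_dvd_den_mul_natCast_iff {p : ℕ} (hp : p.Prime) {b : ℚ} (hb : Squarefree b.den)
    (c : ℕ) : p ∣ (b * c).den ↔ p ∣ b.den ∧ ¬ p ∣ c := by
  constructor
  · intro h
    have hpb : p ∣ b.den := h.trans (by simpa using Rat.mul_den_dvd b c)
    refine ⟨hpb, ?_⟩
    rintro ⟨c', rfl⟩
    obtain ⟨e, he⟩ := hpb
    have hpe : p ∣ e := by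
      refine h.trans ((den_dvd_iff_exists_int _ _).2 ⟨b.num * c', ?_⟩)
      push_cast
      rw [← Rat.den_mul_eq_num b, he]
      push_cast
      ring
    have hpp : p * p ∣ b.den := he ▸ Nat.mul_dvd_mul_left p hpe
    exact hp.not_isUnit (hb p hpp)
  · rintro ⟨hpb, hpc⟩
    have h : b.den ∣ (b * c).den * c := by
      obtain ⟨z, hz⟩ := (den_dvd_iff_exists_int (b * c) _).1 dvd_rfl
      refine (den_dvd_iff_exists_int _ _).2 ⟨z, ?_⟩
      rw [hz]
      push_cast
      ring
    exact (hp.dvd_mul.1 (hpb.trans h)).resolve_right hpc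

theorem den_sum_one_div_prime (s : Finset ℕ) (hs : ∀ q ∈ s, q.Prime) :
    (∑ q ∈ s, (1 : ℚ) / q).den = ∏ q ∈ s, q := by
  induction s using Finset.induction_on with
  | empty => simp
  | insert a s ha ih =>
    have ih' := ih fun q hq => hs q (Finset.mem_insert_of_mem hq)
    have hap : a.Prime := hs a (Finset.mem_insert_self a s)
    have hden : ((1 : ℚ) / a).den = a := by simp [hap.ne_zero]
    rw [Finset.sum_insert ha, Finset.prod_insert ha, den_add_of_coprime, ih', hden]
    rw [hden, ih']
    refine Nat.Coprime.prod_right fun q hq => ?_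
    rw [Nat.coprime_primes hap (hs q (Finset.mem_insert_of_mem hq))]
    rintro rfl
    exact ha hq

/-! ### Denominators of Bernoulli numbers -/

theorem den_bernoulli_two_mul (k : ℕ) :
    (_root_.bernoulli (2 * k)).den =
      ∏ p ∈ Finset.range (2 * k + 2) with p.Prime ∧ (p - 1) ∣ 2 * k, p := by
  obtain ⟨z, hz⟩ := Bernoulli.vonStaudt_clausen k
  rw [eq_sub_of_add_eq hz.symm, ← den_sum_one_div_prime]
  · rw [sub_eq_add_neg, den_add_of_coprime] <;> simp
  · intro q hq
    exact (Finset.mem_filter.1 hq).2.1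

theorem den_bernoulli_one : (_root_.bernoulli 1).den = 2 := by
  rw [_root_.bernoulli_one]
  norm_num

theorem squarefree_den_bernoulli (k : ℕ) : Squarefree (_root_.bernoulli k).den := by
  rcases Nat.even_or_odd' k with ⟨m, rfl | rfl⟩
  · rw [den_bernoulli_two_mul]
    refine Finset.squarefree_prod_of_pairwise_isCoprime ?_ fun p hp => ?_
    · intro p hp q hq hpq
      have hp' := (Finset.mem_filter.1 hp).2.1
      have hq' := (Finset.mem_filter.1 hq).2.1
      exact Nat.coprime_iff_isRelPrime.1 ((Nat.coprime_primes hp' hq').2 hpq)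
    · exact (Finset.mem_filter.1 hp).2.1.prime.squarefree
  · rcases Nat.eq_zero_or_pos m with rfl | hm
    · rw [mul_zero, zero_add, den_bernoulli_one]
      exact Nat.prime_two.prime.squarefree
    · rw [bernoulli_eq_zero_of_odd ⟨m, rfl⟩ (by omega)]
      simp

theorem prime_dvd_den_bernoulli_iff {p : ℕ} (hp : p.Prime) (k : ℕ) :
    p ∣ (_root_.bernoulli k).den ↔ 0 < k ∧ (k = 1 ∨ Even k) ∧ (p - 1) ∣ k := by
  rcases Nat.even_or_odd' k with ⟨m, rfl | rfl⟩
  · rw [den_bernoulli_two_mul, hp.prime.dvd_finsetProd_iff]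
    constructor
    · rintro ⟨q, hq, hpq⟩
      obtain ⟨hq1, hq2, hq3⟩ := Finset.mem_filter.1 hq
      obtain rfl := (Nat.prime_dvd_prime_iff_eq hp hq2).1 hpq
      have := hp.two_le
      have := Finset.mem_range.1 hq1
      exact ⟨by omega, Or.inr (even_two_mul m), hq3⟩
    · rintro ⟨h0, -, h⟩
      have := Nat.le_of_dvd h0 h
      exact ⟨p, Finset.mem_filter.2 ⟨Finset.mem_range.2 (by omega), hp, h⟩, dvd_rfl⟩
  · rcases Nat.eq_zero_or_pos m with rfl | hm
    · have := hp.two_le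
      rw [mul_zero, zero_add, den_bernoulli_one, Nat.prime_dvd_prime_iff_eq hp Nat.prime_two,
        Nat.dvd_one]
      omega
    · rw [bernoulli_eq_zero_of_odd ⟨m, rfl⟩ (by omega)]
      have h1 : ¬ Even (2 * m + 1) := by simp
      have h2 : 2 * m + 1 ≠ 1 := by omega
      simp only [h1, h2, Rat.den_zero, Nat.dvd_one, or_self, false_and, and_false, iff_false]
      exact hp.ne_one

/-! ### Denominators of polynomials -/

theorem exists_map_eq_smul_iff (f : ℚ[X]) (d : ℕ) :
    (∃ g : ℤ[X], g.map (Int.castRingHom ℚ) = (d : ℚ) • f) ↔ ∀ i, (f.coeff i).den ∣ d := by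
  constructor
  · rintro ⟨g, hg⟩ i
    refine (den_dvd_iff_exists_int _ _).2 ⟨g.coeff i, ?_⟩
    simpa using congrArg (fun q : ℚ[X] => q.coeff i) hg
  · intro h
    have hl : (d : ℚ) • f ∈ Polynomial.lifts (Int.castRingHom ℚ) := by
      rw [Polynomial.lifts_iff_coeff_lifts]
      intro i
      obtain ⟨z, hz⟩ := (den_dvd_iff_exists_int _ _).1 (h i)
      exact ⟨z, by simpa using hz⟩
    exact (Polynomial.mem_lifts _).1 hl

theorem denom_eq_lcm (f : ℚ[X]) : denom f = f.support.lcm fun i => (f.coeff i).den := by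
  obtain ⟨⟨h0, h1⟩, h2⟩ := isLeast_denom f
  refine le_antisymm (h2 ⟨?_, ?_⟩) ?_
  · refine Nat.pos_of_ne_zero fun h => ?_
    obtain ⟨i, -, hi⟩ := Finset.lcm_eq_zero_iff.1 h
    exact (f.coeff i).den_ne_zero hi
  · refine (exists_map_eq_smul_iff f _).2 fun i => ?_
    by_cases hi : f.coeff i = 0
    · simp [hi]
    · exact Finset.dvd_lcm (f := fun i => (f.coeff i).den) (mem_support_iff.2 hi)
  · exact Nat.le_of_dvd h0 (Finset.lcm_dvd fun i _ => (exists_map_eq_smul_iff f _).1 h1 i)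

theorem prime_pow_dvd_lcm {p : ℕ} (hp : p.Prime) (k : ℕ) {a b : ℕ} (ha : a ≠ 0) (hb : b ≠ 0)
    (h : p ^ k ∣ Nat.lcm a b) : p ^ k ∣ a ∨ p ^ k ∣ b := by
  rw [hp.pow_dvd_iff_le_factorization (Nat.lcm_ne_zero ha hb), Nat.factorization_lcm ha hb,
    Finsupp.sup_apply, le_sup_iff] at h
  rwa [hp.pow_dvd_iff_le_factorization ha, hp.pow_dvd_iff_le_factorization hb]

theorem exists_prime_pow_dvd_of_dvd_finset_lcm {ι : Type*} {p : ℕ} (hp : p.Prime) {k : ℕ}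
    (hk : k ≠ 0) (s : Finset ι) (f : ι → ℕ) (hf : ∀ i ∈ s, f i ≠ 0) (h : p ^ k ∣ s.lcm f) :
    ∃ i ∈ s, p ^ k ∣ f i := by
  classical
  induction s using Finset.induction_on with
  | empty =>
    rw [Finset.lcm_empty, Nat.dvd_one, Nat.pow_eq_one] at h
    exact absurd h (by simp [hk, hp.ne_one])
  | insert a s ha ih =>
    rw [Finset.lcm_insert] at h
    have hs : s.lcm f ≠ 0 := fun h0 => by
      obtain ⟨i, hi, hi0⟩ := Finset.lcm_eq_zero_iff.1 h0
      exact hf i (Finset.mem_insert_of_mem hi) hi0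
    rcases prime_pow_dvd_lcm hp k (hf a (Finset.mem_insert_self a s)) hs h with h | h
    · exact ⟨a, Finset.mem_insert_self a s, h⟩
    · obtain ⟨i, hi, hi'⟩ := ih (fun i hi => hf i (Finset.mem_insert_of_mem hi)) h
      exact ⟨i, Finset.mem_insert_of_mem hi, hi'⟩

theorem prime_pow_dvd_denom_iff {p : ℕ} (hp : p.Prime) {k : ℕ} (hk : k ≠ 0) (f : ℚ[X]) :
    p ^ k ∣ denom f ↔ ∃ i, p ^ k ∣ (f.coeff i).den := by
  constructor
  · intro h
    rw [denom_eq_lcm] at h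
    obtain ⟨i, -, hi⟩ := exists_prime_pow_dvd_of_dvd_finset_lcm hp hk _ _
      (fun i _ => (f.coeff i).den_ne_zero) h
    exact ⟨i, hi⟩
  · rintro ⟨i, hi⟩
    exact hi.trans ((exists_map_eq_smul_iff f _).1 (isLeast_denom f).1.2 i)

theorem prime_dvd_denom_iff {p : ℕ} (hp : p.Prime) (f : ℚ[X]) :
    p ∣ denom f ↔ ∃ i, p ∣ (f.coeff i).den := by
  simpa using prime_pow_dvd_denom_iff hp one_ne_zero f

theorem squarefree_denom {f : ℚ[X]} (h : ∀ i, Squarefree (f.coeff i).den) :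
    Squarefree (denom f) := by
  rw [Nat.squarefree_iff_prime_squarefree]
  intro p hp hpp
  rw [← sq, prime_pow_dvd_denom_iff hp two_ne_zero] at hpp
  obtain ⟨i, hi⟩ := hpp
  exact hp.not_isUnit (h i p (by rwa [← sq]))

/-! ### Denominators of Bernoulli polynomials -/

theorem squarefree_den_coeff_bernoulli (n i : ℕ) :
    Squarefree ((Polynomial.bernoulli n).coeff i).den := by
  rw [coeff_bernoulli]
  split_ifs
  · exact (squarefree_den_bernoulli (n - i)).squarefree_of_dvd
      (by simpa using Rat.mul_den_dvd (_root_.bernoulli (n - i)) (n.choose i))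
  · simp

theorem coeff_bernoulli_sub_C (n i : ℕ) :
    (Polynomial.bernoulli n - C (_root_.bernoulli n)).coeff i =
      if i = 0 then 0 else (Polynomial.bernoulli n).coeff i := by
  rw [coeff_sub, coeff_C]
  split_ifs with h
  · subst h
    simp [coeff_bernoulli]
  · simp

theorem squarefree_fB (n : ℕ) : Squarefree (fB n) :=
  squarefree_denom (squarefree_den_coeff_bernoulli n)

theorem squarefree_fD (n : ℕ) : Squarefree (fD n) := by
  refine squarefree_denom fun i => ?_
  rw [coeff_bernoulli_sub_C]
  split_ifs
  · simp
  · exact squarefree_den_coeff_bernoulli n i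

theorem prime_dvd_den_coeff_bernoulli_iff {p : ℕ} (hp : p.Prime) (n i : ℕ) :
    p ∣ ((Polynomial.bernoulli n).coeff i).den ↔
      i ≤ n ∧ p ∣ (_root_.bernoulli (n - i)).den ∧ ¬ p ∣ n.choose (n - i) := by
  rw [coeff_bernoulli]
  split_ifs with h
  · rw [prime_dvd_den_mul_natCast_iff hp (squarefree_den_bernoulli _), Nat.choose_symm h]
    simp [h]
  · simp [h, hp.ne_one]

theorem prime_dvd_fB_iff {p : ℕ} (hp : p.Prime) (n : ℕ) :
    p ∣ fB n ↔ ∃ k ≤ n, p ∣ (_root_.bernoulli k).den ∧ ¬ p ∣ n.choose k := by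
  rw [fB, prime_dvd_denom_iff hp]
  simp only [prime_dvd_den_coeff_bernoulli_iff hp]
  constructor
  · rintro ⟨i, -, h⟩
    exact ⟨n - i, Nat.sub_le n i, h⟩
  · rintro ⟨k, hk, h⟩
    exact ⟨n - k, Nat.sub_le n k, by rwa [Nat.sub_sub_self hk]⟩

theorem prime_dvd_fD_iff {p : ℕ} (hp : p.Prime) (n : ℕ) :
    p ∣ fD n ↔ ∃ k < n, p ∣ (_root_.bernoulli k).den ∧ ¬ p ∣ n.choose k := by
  rw [fD, prime_dvd_denom_iff hp]
  simp only [coeff_bernoulli_sub_C]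
  constructor
  · rintro ⟨i, h⟩
    split_ifs at h with hi
    · exact absurd (by simpa using h) hp.ne_one
    · obtain ⟨hin, h⟩ := (prime_dvd_den_coeff_bernoulli_iff hp n i).1 h
      exact ⟨n - i, by omega, h⟩
  · rintro ⟨k, hk, h⟩
    refine ⟨n - k, ?_⟩
    rw [if_neg (by omega), prime_dvd_den_coeff_bernoulli_iff hp, Nat.sub_sub_self hk.le]
    exact ⟨Nat.sub_le n k, h⟩

/-! ### Binomial coefficients modulo a prime -/

theorem choose_prime_pow_mul_modEq {p : ℕ} (hp : p.Prime) (j c : ℕ) :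
    (p ^ j * c).choose (p ^ j) ≡ c [MOD p] := by
  have : Fact p.Prime := ⟨hp⟩
  induction j with
  | zero => simpa using Nat.ModEq.refl c
  | succ j ih =>
    have h := Choose.choose_modEq_choose_mod_mul_choose_div_nat
      (n := p ^ (j + 1) * c) (k := p ^ (j + 1)) (p := p)
    rw [pow_succ', mul_assoc, Nat.mul_mod_right, Nat.mul_mod_right,
      Nat.mul_div_cancel_left _ hp.pos, Nat.mul_div_cancel_left _ hp.pos, Nat.choose_self,
      one_mul] at h
    rw [pow_succ', mul_assoc]
    exact h.trans ih

/-- If `p ^ j` exactly divides `b`, then `p ^ j` can be moved from `b` to `a` in the binomial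
coefficient `(a + b).choose a` without creating a factor `p`. -/
theorem exists_pow_not_dvd_choose_add {p : ℕ} (hp : p.Prime) {a b : ℕ} (hb : b ≠ 0)
    (h : ¬ p ∣ (a + b).choose a) :
    ∃ j, p ^ j ≤ b ∧ ¬ p ∣ (a + b).choose (a + p ^ j) := by
  obtain ⟨j, c, hc, hbc⟩ := Nat.exists_eq_pow_mul_and_not_dvd hb p hp.ne_one
  have hle : p ^ j ≤ b := Nat.le_of_dvd (Nat.pos_of_ne_zero hb) ⟨c, hbc⟩
  refine ⟨j, hle, fun hd => ?_⟩
  have key := Nat.choose_mul (n := a + b) (k := a + p ^ j) (s := a) (by omega)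
  rw [Nat.add_sub_cancel_left, Nat.add_sub_cancel_left] at key
  have h1 : p ∣ (a + b).choose a * b.choose (p ^ j) := key ▸ hd.mul_right _
  have h2 : p ∣ b.choose (p ^ j) := (hp.dvd_mul.1 h1).resolve_left h
  rw [hbc] at h2
  exact hc (((choose_prime_pow_mul_modEq hp j c).dvd_iff dvd_rfl).1 h2)

theorem exists_not_dvd_choose_of_succ {p : ℕ} (hp : p.Prime) {n k : ℕ}
    (hk0 : 0 < k) (hkn : k ≤ n) (hpk : (p - 1) ∣ k) (h : ¬ p ∣ (n + 1).choose k) :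
    ∃ k', 0 < k' ∧ k' ≤ n ∧ (p - 1) ∣ k' ∧ ¬ p ∣ n.choose k' := by
  by_cases hc : p ∣ n.choose k
  · obtain ⟨a, rfl⟩ : ∃ a, k = a + 1 := ⟨k - 1, by omega⟩
    obtain ⟨b, rfl⟩ : ∃ b, n = a + b := ⟨n - a, by omega⟩
    have h3 : ¬ p ∣ (a + b).choose a := fun hd => by
      refine h ?_
      rw [Nat.choose_succ_succ]
      exact dvd_add hd hc
    obtain ⟨j, hj, hd⟩ := exists_pow_not_dvd_choose_add hp (by omega) h3
    have hpos : 0 < p ^ j := pow_pos hp.pos j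
    refine ⟨a + p ^ j, by omega, by omega, ?_, hd⟩
    have h4 : p - 1 ∣ p ^ j - 1 := Nat.sub_one_dvd_pow_sub_one p j
    have h5 : a + p ^ j = (a + 1) + (p ^ j - 1) := by omega
    rw [h5]
    exact dvd_add hpk h4
  · exact ⟨k, hk0, hkn, hpk, hc⟩

theorem not_dvd_choose_prime_sub_one {p n : ℕ} (hp : p.Prime) (h : p ∣ n + 1) :
    ¬ p ∣ n.choose (p - 1) := by
  have : Fact p.Prime := ⟨hp⟩
  have hp2 := hp.two_le
  obtain ⟨m, hm⟩ := h
  obtain ⟨m, rfl⟩ : ∃ l, m = l + 1 := ⟨m - 1, by rcases m with _ | m <;> omega⟩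
  have hn : n = (p - 1) + p * m := by
    rw [mul_add] at hm
    omega
  have h1 := Choose.choose_modEq_choose_mod_mul_choose_div_nat (n := n) (k := p - 1) (p := p)
  have hlt : p - 1 < p := by omega
  rw [hn, Nat.add_mul_mod_self_left, Nat.mod_eq_of_lt hlt, Nat.choose_self,
    Nat.div_eq_of_lt hlt, Nat.choose_zero_right] at h1
  rw [hn, h1.dvd_iff dvd_rfl, one_mul, Nat.dvd_one]
  exact hp.ne_one

theorem exists_not_dvd_choose_iff_succ {p : ℕ} (hp : p.Prime) (n : ℕ) :
    (∃ k, 0 < k ∧ k ≤ n ∧ (p - 1) ∣ k ∧ ¬ p ∣ n.choose k) ↔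
      (∃ k, 0 < k ∧ k ≤ n ∧ (p - 1) ∣ k ∧ ¬ p ∣ (n + 1).choose k) ∨ p ∣ n + 1 := by
  constructor
  · rintro ⟨k, hk0, hkn, hpk, h⟩
    refine or_iff_not_imp_right.2 fun hn => ⟨k, hk0, hkn, hpk, fun hd => ?_⟩
    have h1 : n.choose k * (n + 1) = (n + 1).choose k * (n + 1 - k) :=
      Nat.choose_mul_succ_eq n k
    exact (hp.dvd_mul.1 (h1 ▸ hd.mul_right _)).elim h hn
  · rintro (⟨k, hk0, hkn, hpk, h⟩ | h)
    · exact exists_not_dvd_choose_of_succ hp hk0 hkn hpk h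
    · have := Nat.le_of_dvd n.succ_pos h
      have := hp.two_le
      exact ⟨p - 1, by omega, by omega, dvd_rfl, not_dvd_choose_prime_sub_one hp h⟩

/-! ### Comparison of consecutive denominators -/

theorem even_of_prime_sub_one_dvd {p k : ℕ} (hp : p.Prime) (hp2 : p ≠ 2) (h : (p - 1) ∣ k) :
    Even k :=
  (hp.even_sub_one hp2).trans_dvd h

theorem odd_prime_dvd_den_bernoulli_iff {p : ℕ} (hp : p.Prime) (hp2 : p ≠ 2) (k : ℕ) :
    p ∣ (_root_.bernoulli k).den ↔ 0 < k ∧ (p - 1) ∣ k := by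
  rw [prime_dvd_den_bernoulli_iff hp]
  exact ⟨fun h => ⟨h.1, h.2.2⟩,
    fun h => ⟨h.1, Or.inr (even_of_prime_sub_one_dvd hp hp2 h.2), h.2⟩⟩

theorem odd_prime_dvd_fB_iff {p : ℕ} (hp : p.Prime) (hp2 : p ≠ 2) (n : ℕ) :
    p ∣ fB n ↔ ∃ k, 0 < k ∧ k ≤ n ∧ (p - 1) ∣ k ∧ ¬ p ∣ n.choose k := by
  rw [prime_dvd_fB_iff hp]
  simp only [odd_prime_dvd_den_bernoulli_iff hp hp2]
  exact exists_congr fun k => by tauto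

theorem odd_prime_dvd_fD_succ_iff {p : ℕ} (hp : p.Prime) (hp2 : p ≠ 2) (n : ℕ) :
    p ∣ fD (n + 1) ↔ ∃ k, 0 < k ∧ k ≤ n ∧ (p - 1) ∣ k ∧ ¬ p ∣ (n + 1).choose k := by
  rw [prime_dvd_fD_iff hp]
  simp only [odd_prime_dvd_den_bernoulli_iff hp hp2, Nat.lt_succ_iff]
  exact exists_congr fun k => by tauto

theorem odd_prime_dvd_fD_iff_dvd_fB {p n : ℕ} (hp : p.Prime) (hp2 : p ≠ 2) (hn : Odd n) :
    p ∣ fD n ↔ p ∣ fB n := by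
  rw [prime_dvd_fD_iff hp, prime_dvd_fB_iff hp]
  constructor
  · rintro ⟨k, hk, h⟩
    exact ⟨k, hk.le, h⟩
  · rintro ⟨k, hk, h⟩
    refine ⟨k, lt_of_le_of_ne hk ?_, h⟩
    rintro rfl
    have hpk := ((odd_prime_dvd_den_bernoulli_iff hp hp2 k).1 h.1).2
    exact (Nat.not_even_iff_odd.2 hn) (even_of_prime_sub_one_dvd hp hp2 hpk)

theorem odd_prime_dvd_fB_iff_dvd_fD_succ {p : ℕ} (hp : p.Prime) (hp2 : p ≠ 2) (n : ℕ) :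
    p ∣ fB n ↔ p ∣ fD (n + 1) ∨ p ∣ n + 1 := by
  rw [odd_prime_dvd_fB_iff hp hp2, odd_prime_dvd_fD_succ_iff hp hp2,
    exists_not_dvd_choose_iff_succ hp]

theorem two_dvd_fD_of_odd {n : ℕ} (hn : Odd n) (h : 1 < n) : 2 ∣ fD n := by
  rw [prime_dvd_fD_iff Nat.prime_two]
  refine ⟨1, h, (prime_dvd_den_bernoulli_iff Nat.prime_two 1).2 (by simp), ?_⟩
  rw [Nat.choose_one_right]
  exact hn.not_two_dvd_nat

theorem two_dvd_fB_of_even {n : ℕ} (hn : Even n) (h : 0 < n) : 2 ∣ fB n := by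
  rw [prime_dvd_fB_iff Nat.prime_two]
  exact ⟨n, le_rfl, (prime_dvd_den_bernoulli_iff Nat.prime_two n).2 (by simp [h, hn]), by simp⟩

theorem eq_lcm_radical_of_prime_dvd_iff {a b n : ℕ} (ha : Squarefree a) (hb : Squarefree b)
    (hn : n ≠ 0) (h : ∀ p, p.Prime → (p ∣ a ↔ p ∣ b ∨ p ∣ n)) :
    a = Nat.lcm b (UniqueFactorizationMonoid.radical n) := by
  have hrad : Squarefree (UniqueFactorizationMonoid.radical n) :=
    UniqueFactorizationMonoid.squarefree_radical
  have hl : Squarefree (Nat.lcm b (UniqueFactorizationMonoid.radical n)) := by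
    rw [Nat.squarefree_iff_prime_squarefree]
    intro p hp hpp
    rw [← sq] at hpp
    rcases prime_pow_dvd_lcm hp 2 hb.ne_zero hrad.ne_zero hpp with h | h
    · exact hp.not_isUnit (hb p (by rwa [← sq]))
    · exact hp.not_isUnit (hrad p (by rwa [← sq]))
  refine (Nat.Squarefree.ext_iff ha hl).2 fun p hp => ?_
  rw [h p hp, hp.dvd_lcm,
    UniqueFactorizationMonoid.dvd_radical_iff_of_irreducible hp.prime.irreducible hn]

theorem fD_eq_lcm {n : ℕ} (hn : Odd n) (h : 1 < n) :
    fD n = Nat.lcm (fD (n + 1)) (UniqueFactorizationMonoid.radical (n + 1)) := by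
  refine eq_lcm_radical_of_prime_dvd_iff (squarefree_fD n) (squarefree_fD _) n.succ_ne_zero
    fun p hp => ?_
  by_cases hp2 : p = 2
  · subst hp2
    exact iff_of_true (two_dvd_fD_of_odd hn h) (Or.inr hn.add_one.two_dvd)
  · rw [odd_prime_dvd_fD_iff_dvd_fB hp hp2 hn, odd_prime_dvd_fB_iff_dvd_fD_succ hp hp2]

theorem fB_eq_lcm {n : ℕ} (hn : Even n) (h : 0 < n) :
    fB n = Nat.lcm (fB (n + 1)) (UniqueFactorizationMonoid.radical (n + 1)) := by
  refine eq_lcm_radical_of_prime_dvd_iff (squarefree_fB n) (squarefree_fB _) n.succ_ne_zero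
    fun p hp => ?_
  by_cases hp2 : p = 2
  · subst hp2
    refine iff_of_true (two_dvd_fB_of_even hn h) (Or.inl ?_)
    rw [prime_dvd_fB_iff Nat.prime_two]
    obtain ⟨k, hk, hd⟩ := (prime_dvd_fD_iff Nat.prime_two _).1
      (two_dvd_fD_of_odd hn.add_one (by omega))
    exact ⟨k, hk.le, hd⟩
  · rw [← odd_prime_dvd_fD_iff_dvd_fB hp hp2 hn.add_one, odd_prime_dvd_fB_iff_dvd_fD_succ hp hp2]

theorem fD_two : fD 2 = 1 := by
  by_contra h
  obtain ⟨p, hp, hpd⟩ := Nat.exists_prime_and_dvd h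
  obtain ⟨k, hk, hd, hc⟩ := (prime_dvd_fD_iff hp 2).1 hpd
  obtain ⟨h0, -, hpk⟩ := (prime_dvd_den_bernoulli_iff hp k).1 hd
  obtain rfl : k = 1 := by omega
  have := hp.two_le
  obtain rfl : p = 2 := by
    have := Nat.dvd_one.1 hpk
    omega
  exact hc (by simp)

end BernoulliDenom

theorem corollary2 :
    ((∀ n : ℕ, 3 ≤ n → Odd n →
        BernoulliDenom.fD n =
          Nat.lcm (BernoulliDenom.fD (n + 1)) (UniqueFactorizationMonoid.radical (n + 1))) ∧
      (∀ n : ℕ, 2 ≤ n → Even n →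
        BernoulliDenom.fB n =
          Nat.lcm (BernoulliDenom.fB (n + 1)) (UniqueFactorizationMonoid.radical (n + 1)))) ∧
    ((∀ n : ℕ, 1 ≤ n → Odd n → BernoulliDenom.fD (n + 1) ∣ BernoulliDenom.fD n) ∧
      (∀ n : ℕ, 2 ≤ n → Even n → BernoulliDenom.fB (n + 1) ∣ BernoulliDenom.fB n)) := by
  refine ⟨⟨fun n h3 hn => BernoulliDenom.fD_eq_lcm hn (by omega),
    fun n h2 hn => BernoulliDenom.fB_eq_lcm hn (by omega)⟩, fun n h1 hn => ?_, fun n h2 hn => ?_⟩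
  · rcases h1.eq_or_lt with rfl | h
    · rw [BernoulliDenom.fD_two]
      exact one_dvd _
    · rw [BernoulliDenom.fD_eq_lcm hn h]
      exact Nat.dvd_lcm_left _ _
  · rw [BernoulliDenom.fB_eq_lcm hn (by omega)]
    exact Nat.dvd_lcm_left _ _
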